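/- **Setting.** Let $H=(V,E,w)$ be a finite hypergraph with non-empty hyperedges and positive weights, in which every vertex has positive degree $\deg_H(v)=\sum_{e\ni v}w(e)$. Let $D_H$ be the diagonal matrix of these degrees, $n=|V|$, $\langle f,h\rangle_w=f^{\top}D_H h$ and $\|f\|_w^2=\langle f,f\rangle_w$. For $f\in\mathbb R^V$ and $e\in E$ let $S_f(e)$ and $I_f(e)$ be the sets of vertices of $e$ at which $f|_e$ attains its maximum and its minimum, and let $\Delta_f(e)=\max_{e} f+\min_{e} f$. A graph $G$ *represents the diffusion operator $J_H$ at $f$* if it arises by splitting the weight $w(e)$ of every hyperedge $e$ into (real) weights of edges in $S_f(e)\times I_f(e)$, in such a way that $r=-D_H^{-1}(D_G+A_G)f=\sum_{e}r_e$, where $r_e$ is the contribution of the part of $G$ coming from $e$, obeys the following rules for all $e\in E$. * If $u\in S_f(e)$ and $r_e(u)\neq 0$, then $r(u)=\max_{v\in S_f(e)}r(v)$ when $\Delta_f(e)>0$, and $r(u)=r(v)$ for all $v\in S_f(e)$ when $\Delta_f(e)<0$. * If $u\in I_f(e)$ and $r_e(u)\neq 0$, then $r(u)=\min_{v\in I_f(e)}r(v)$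 when $\Delta_f(e)<0$, and $r(u)=r(v)$ for all $v\in I_f(e)$ when $\Delta_f(e)>0$. (Here $A_G$ is the symmetric adjacency matrix, in which a loop counts twice, and $D_G$ is the diagonal matrix of its row sums.) A *diffusion process* of $H$ is a continuous curve $(f_t)_{t\ge 0}$ in $\mathbb R^V$ together with graphs $(G_t)_{t\geq 0}$ such that, for every $t\ge 0$, $G_t$ represents $J_H$ at $f_t$ and the forward derivative satisfies $\frac{\mathrm d f_t}{\mathrm dt}=-D_H^{-1}J_tf_t$, where $J_t=D_{G_t}+A_{G_t}$ is the signless Laplacian of $G_t$. **Theorem.** There is an absolute constant $C>0$ such that for every such $H$, every $\varepsilon>0$ and every diffusion process of $H$ with starting vector $f_0\neq 0$ there are a time $0\le t\le C/\varepsilon^3$ and an interval $[c,c+2\varepsilon]$ for which $\|f_t\|_w>0$, the matrix $D_H^{-1}J_t$ has a full system of eigen-pairs $(u_i,\lambda_i)_{i=1}^n$ orthonormal for $\langle\cdot,\cdot\rangle_w$, and for every such system $$\frac1{\|f_t\|_w^2}\sum_{i:\ \lambda_i\in[c,c+2\varepsilon]}\langle f_t,u_i\rangle_w^2\ \ge\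 1-\varepsilon \qquad\text{and}\qquad \frac1{\|f_t\|_w}\sum_{i:\ \lambda_i\in[c,c+2\varepsilon]}\bigl|\langle f_t,u_i\rangle_w\bigr|\ \ge\ 1-\varepsilon .$$ -/

import Mathlib

/-- A finite weighted hypergraph on the vertex set `V`: a finite set of non-empty hyperedges,
each carrying a positive weight. -/
structure WeightedHypergraph (V : Type*) where
  edges : Finset (Finset V)
  weight : Finset V → ℝ
  edge_nonempty : ∀ e ∈ edges, e.Nonempty
  weight_pos : ∀ e ∈ edges, 0 < weight e

namespace WeightedHypergraph

noncomputable section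

variable {V : Type*} [Fintype V] [DecidableEq V]

/-- `deg_H(v)`: the total weight of the hyperedges containing `v`. -/
def deg (H : WeightedHypergraph V) (v : V) : ℝ :=
  ∑ e ∈ H.edges, if v ∈ e then H.weight e else 0

/-- The diagonal matrix `D_H` of hypergraph degrees. -/
def degMatrix (H : WeightedHypergraph V) : Matrix V V ℝ :=
  Matrix.diagonal H.deg

/-- The weighted inner product `⟨f, h⟩_w = fᵀ D_H h`. -/
def wInner (H : WeightedHypergraph V) (f h : V → ℝ) : ℝ :=
  f ⬝ᵥ (H.degMatrix.mulVec h)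

/-- The weighted norm, `‖f‖_w ^ 2 = ⟨f, f⟩_w`. -/
def wNorm (H : WeightedHypergraph V) (f : V → ℝ) : ℝ :=
  Real.sqrt (H.wInner f f)

/-- `S_f(e)`: the vertices of `e` at which `f` is maximal on `e`. -/
def maxSet (f : V → ℝ) (e : Finset V) : Finset V :=
  e.filter fun v => ∀ u ∈ e, f u ≤ f v

/-- `I_f(e)`: the vertices of `e` at which `f` is minimal on `e`. -/
def minSet (f : V → ℝ) (e : Finset V) : Finset V :=
  e.filter fun v => ∀ u ∈ e, f v ≤ f u

/-- The discrepancy `Δ_f(e) = max_{u ∈ e} f(u) + min_{v ∈ e} f(v)`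
(with the irrelevant value `0` for the empty set, which is never a hyperedge). -/
def discrepancy (f : V → ℝ) (e : Finset V) : ℝ :=
  if h : e.Nonempty then e.sup' h f + e.inf' h f else 0

/-- The signless Laplacian `J = D + A` of a weighted graph with adjacency matrix `A`,
where `D` is the diagonal matrix of the degrees `∑ v, A u v`. -/
def signlessLaplacian (A : Matrix V V ℝ) : Matrix V V ℝ :=
  Matrix.diagonal (fun u => ∑ v, A u v) + A

/-- A splitting `g` puts the weight `g e u v` on the graph edge joining `u` and `v` on behalf of
the hyperedge `e`. `edgeAdj g e` is the adjacency matrix of the part of the graph coming from `e`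
(an edge joining `u` to itself counts twice on the diagonal, as an edge has two ends). -/
def edgeAdj (g : Finset V → V → V → ℝ) (e : Finset V) : Matrix V V ℝ :=
  Matrix.of fun u v => g e u v + g e v u

/-- The adjacency matrix `A_G` of the graph `G` defined by the splitting `g`. -/
def graphAdj (H : WeightedHypergraph V) (g : Finset V → V → V → ℝ) : Matrix V V ℝ :=
  ∑ e ∈ H.edges, edgeAdj g e

/-- The operator `D_H⁻¹ J_G = D_H⁻¹ (D_G + A_G)` of the graph `G` defined by `g`. -/
def diffusionMatrix (H : WeightedHypergraph V) (g : Finset V → V → V → ℝ) : Matrix V V ℝ :=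
  H.degMatrix⁻¹ * signlessLaplacian (H.graphAdj g)

/-- The rate of change `r = - D_H⁻¹ J_G f`. -/
def rate (H : WeightedHypergraph V) (f : V → ℝ) (g : Finset V → V → V → ℝ) : V → ℝ :=
  -((H.diffusionMatrix g).mulVec f)

/-- The contribution `r_e` of the hyperedge `e` to the rate of change. -/
def edgeRate (H : WeightedHypergraph V) (f : V → ℝ) (g : Finset V → V → V → ℝ)
    (e : Finset V) : V → ℝ :=
  -((H.degMatrix⁻¹ * signlessLaplacian (edgeAdj g e)).mulVec f)

/-- `g` defines a graph `G` representing the diffusion operator `J_H` at the vector `f`: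
the weight of every hyperedge `e` is split between the edges in `S_f(e) × I_f(e)`, and the
resulting rates of change obey the participation rules on maximal vertices (`max_*`) and on
minimal vertices (`min_*`). No sign is imposed on the individual shares `g e u v`. -/
structure IsDiffusionGraph (H : WeightedHypergraph V) (f : V → ℝ)
    (g : Finset V → V → V → ℝ) : Prop where
  support : ∀ e ∈ H.edges, ∀ u v, g e u v ≠ 0 → u ∈ maxSet f e ∧ v ∈ minSet f e
  total : ∀ e ∈ H.edges, ∑ u, ∑ v, g e u v = H.weight e
  max_of_pos : ∀ e ∈ H.edges, 0 < discrepancy f e →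
    ∀ u ∈ maxSet f e, 0 < |H.edgeRate f g e u| →
      ∀ v ∈ maxSet f e, H.rate f g v ≤ H.rate f g u
  max_of_neg : ∀ e ∈ H.edges, discrepancy f e < 0 →
    ∀ u ∈ maxSet f e, 0 < |H.edgeRate f g e u| →
      ∀ v ∈ maxSet f e, H.rate f g u = H.rate f g v
  min_of_neg : ∀ e ∈ H.edges, discrepancy f e < 0 →
    ∀ u ∈ minSet f e, 0 < |H.edgeRate f g e u| →
      ∀ v ∈ minSet f e, H.rate f g u ≤ H.rate f g v
  min_of_pos : ∀ e ∈ H.edges, 0 < discrepancy f e →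
    ∀ u ∈ minSet f e, 0 < |H.edgeRate f g e u| →
      ∀ v ∈ minSet f e, H.rate f g u = H.rate f g v

/-- `f` is a diffusion process of `H` for times `t ≥ 0`, driven by the graphs `G_t` given by the
splittings `g t`: `f` is continuous, `G_t` represents `J_H` at `f t`, and
`df_t/dt = - D_H⁻¹ J_{G_t} f_t`, the derivative being the forward one (`f` has kinks at the times
at which the graph changes). -/
structure IsDiffusion (H : WeightedHypergraph V) (f : ℝ → V → ℝ)
    (g : ℝ → Finset V → V → V → ℝ) : Prop where
  continuousOn : ContinuousOn f (Set.Ici 0)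
  graph : ∀ t, 0 ≤ t → H.IsDiffusionGraph (f t) (g t)
  deriv : ∀ t, 0 ≤ t → HasDerivWithinAt f (H.rate (f t) (g t)) (Set.Ici t) t

/-- `(u i, lam i)`, for `i` among `n = |V|` indices, is a full system of eigenpairs of `M`,
orthonormal for the weighted inner product. -/
structure IsEigenSystem (H : WeightedHypergraph V) (M : Matrix V V ℝ)
    (u : Fin (Fintype.card V) → V → ℝ) (lam : Fin (Fintype.card V) → ℝ) : Prop where
  orthonormal : ∀ i j, H.wInner (u i) (u j) = if i = j then 1 else 0
  eigen : ∀ i, M.mulVec (u i) = lam i • u i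

theorem signlessLaplacian_mulVec (A : Matrix V V ℝ) (f : V → ℝ) (u : V) :
    (signlessLaplacian A).mulVec f u = ∑ v, A u v * (f u + f v) := by
  simp only [signlessLaplacian, Matrix.add_mulVec, Pi.add_apply, Matrix.mulVec_diagonal]
  simp only [Matrix.mulVec, dotProduct, Finset.sum_mul, mul_add, Finset.sum_add_distrib]

theorem deg_mul_edgeRate (H : WeightedHypergraph V) (hH : ∀ v, 0 < H.deg v) (f : V → ℝ)
    (g : Finset V → V → V → ℝ) (e : Finset V) (u : V) :
    H.deg u * H.edgeRate f g e u = -∑ v, (g e u v + g e v u) * (f u + f v) := by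
  have hinv : (H.degMatrix)⁻¹ = Matrix.diagonal (fun v => (H.deg v)⁻¹) := by
    apply Matrix.inv_eq_left_inv
    rw [degMatrix, Matrix.diagonal_mul_diagonal, ← Matrix.diagonal_one]
    congr 1
    funext v
    exact inv_mul_cancel₀ (hH v).ne'
  rw [edgeRate, hinv, ← Matrix.mulVec_mulVec, Pi.neg_apply, Matrix.mulVec_diagonal,
    signlessLaplacian_mulVec, mul_neg, ← mul_assoc, mul_inv_cancel₀ (hH u).ne', one_mul]
  rfl

/-- The rate of change is the sum of the contributions of the hyperedges. -/
theorem rate_eq_sum_edgeRate (H : WeightedHypergraph V) (f : V → ℝ)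
    (g : Finset V → V → V → ℝ) (v : V) :
    H.rate f g v = ∑ e ∈ H.edges, H.edgeRate f g e v := by
  simp only [rate, edgeRate, diffusionMatrix, ← Matrix.mulVec_mulVec, Pi.neg_apply,
    Finset.sum_neg_distrib]
  congr 1
  have h : (signlessLaplacian (H.graphAdj g)).mulVec f
      = ∑ e ∈ H.edges, (signlessLaplacian (edgeAdj g e)).mulVec f := by
    funext u
    simp only [Finset.sum_apply, signlessLaplacian_mulVec, graphAdj, Matrix.sum_apply,
      Finset.sum_mul]
    exact Finset.sum_comm
  rw [h, Matrix.mulVec_sum, Finset.sum_apply]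

/-- The rule for the total rate of change: a hyperedge `e` on which `f` is not constant
contributes `- w(e) Δ_f(e)` in total to its maximal vertices. -/
theorem sum_maxSet_deg_mul_edgeRate (H : WeightedHypergraph V) (hH : ∀ v, 0 < H.deg v)
    {f : V → ℝ} {g : Finset V → V → V → ℝ} (hg : H.IsDiffusionGraph f g)
    {e : Finset V} (he : e ∈ H.edges) (hd : Disjoint (maxSet f e) (minSet f e)) :
    ∑ v ∈ maxSet f e, H.deg v * H.edgeRate f g e v = -(H.weight e * discrepancy f e) := by
  have hz : ∀ u v, g e u v ≠ 0 → f u + f v = discrepancy f e := by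
    intro u v h
    obtain ⟨hu, hv⟩ := hg.support e he u v h
    simp only [maxSet, minSet, Finset.mem_filter] at hu hv
    rw [discrepancy, dif_pos ⟨u, hu.1⟩]
    congr 1
    · exact le_antisymm (Finset.le_sup' f hu.1) (Finset.sup'_le _ _ hu.2)
    · exact le_antisymm (Finset.le_inf' _ _ hv.2) (Finset.inf'_le f hv.1)
  have h1 : ∀ u, ∑ v, (g e u v + g e v u) * (f u + f v)
      = if u ∈ maxSet f e then ∑ v, g e u v * discrepancy f e
        else ∑ v, g e v u * (f u + f v) := by
    intro u
    split_ifs with hu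
    · refine Finset.sum_congr rfl fun v _ => ?_
      have h0 : g e v u = 0 := by
        by_contra h
        exact Finset.disjoint_left.mp hd hu (hg.support e he v u h).2
      rw [h0, add_zero]
      by_cases h : g e u v = 0
      · rw [h, zero_mul, zero_mul]
      · rw [hz u v h]
    · refine Finset.sum_congr rfl fun v _ => ?_
      have h0 : g e u v = 0 := by
        by_contra h
        exact hu (hg.support e he u v h).1
      rw [h0, zero_add]
  simp only [deg_mul_edgeRate H hH, Finset.sum_neg_distrib]
  rw [← hg.total e he, Finset.sum_mul]
  congr 1
  rw [← Finset.sum_subset (Finset.subset_univ (maxSet f e))]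
  · refine Finset.sum_congr rfl fun u hu => ?_
    rw [h1 u, if_pos hu, Finset.sum_mul]
  · intro u _ hu
    rw [Finset.sum_eq_zero, zero_mul]
    intro v _
    by_contra h
    exact hu (hg.support e he u v h).1

end

end WeightedHypergraph

/-! Along the flow write N = ‖f‖_w², E = ∑ w(e) Δ_f(e)² and r for the rate. The signless Laplacian
form gives ⟨f, r⟩_w = -E, so N' = -2E. The participation rules give E' = -2‖r‖_w²: the forward
derivative of Δ_f(e) is the largest rate on S_f(e) plus the smallest on I_f(e), and the vertices
through which e acts have exactly these rates (`sum_mul_rate`).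

Hence R = E/N satisfies R' = -2(N‖r‖_w² - E²)/N². In an eigenbasis of D_H⁻¹J the squared
coefficients of f, divided by N, form a probability measure on the spectrum with mean R, and the
fraction is its variance. Since 0 ≤ R ≤ 4, the variance cannot exceed ε³ up to time 3/ε³
(`exists_variance_le`). When it is at most ε³, Chebyshev leaves mass at most ε outside [R - ε, R +
ε]. -/

section RightDerivative

/-! ### Right derivatives of finite maxima and minima -/

open Filter Topology

/-- Just after t only the indices maximal at t compete for the maximum, and they start from a common
value, so the fastest one wins. -/
theorem hasDerivWithinAt_finset_sup' {V : Type*} {f : ℝ → V → ℝ} {r : V → ℝ} {t : ℝ}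
    {e S : Finset V} (he : e.Nonempty) (hS : S.Nonempty)
    (hmem : ∀ v, v ∈ S ↔ v ∈ e ∧ ∀ u ∈ e, f t u ≤ f t v)
    (hf : ∀ v, HasDerivWithinAt (fun s => f s v) (r v) (Set.Ici t) t) :
    HasDerivWithinAt (fun s => e.sup' he (f s)) (S.sup' hS r) (Set.Ici t) t := by
  obtain ⟨w, hw⟩ := hS
  have hwe := (hmem w).1 hw
  have hval : ∀ v ∈ S, f t v = f t w := fun v hv =>
    le_antisymm (hwe.2 v ((hmem v).1 hv).1) (((hmem v).1 hv).2 w hwe.1)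
  have hsupt : e.sup' he (f t) = f t w :=
    le_antisymm (Finset.sup'_le _ _ hwe.2) (Finset.le_sup' (f t) hwe.1)
  rw [← hasDerivWithinAt_Ioi_iff_Ici, hasDerivWithinAt_iff_tendsto_slope' (by simp)]
  have hslope : ∀ v, Tendsto (slope (fun s => f s v) t) (𝓝[>] t) (𝓝 (r v)) := fun v =>
    (hasDerivWithinAt_iff_tendsto_slope' (by simp)).1 (hf v).Ioi_of_Ici
  have hcont : ∀ v, Tendsto (fun s => f s v) (𝓝[>] t) (𝓝 (f t v)) := fun v =>
    (hf v).Ioi_of_Ici.continuousWithinAt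
  have hlim : Tendsto (fun s => S.sup' ⟨w, hw⟩ fun v => slope (fun s => f s v) t s) (𝓝[>] t)
      (𝓝 (S.sup' ⟨w, hw⟩ r)) :=
    Tendsto.finset_sup'_nhds_apply _ fun v _ => hslope v
  refine hlim.congr' ?_
  have hev : ∀ᶠ s in 𝓝[>] t, ∀ v ∈ e, v ∉ S → f s v < f s w := by
    rw [Filter.eventually_all_finset]
    intro v hv
    by_cases hvS : v ∈ S
    · exact Eventually.of_forall fun s h => (h hvS).elim
    · have hlt : f t v < f t w := by
        by_contra! h
        exact hvS ((hmem v).2 ⟨hv, fun u hu => (hwe.2 u hu).trans h⟩)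
      exact ((hcont v).eventually_lt (hcont w) hlt).mono fun s h _ => h
  filter_upwards [hev, self_mem_nhdsWithin] with s hs hst
  have hpos : 0 < s - t := sub_pos.2 hst
  have hsup : e.sup' he (f s) = S.sup' ⟨w, hw⟩ (f s) := by
    apply le_antisymm
    · refine Finset.sup'_le _ _ fun v hv => ?_
      by_cases hvS : v ∈ S
      · exact Finset.le_sup' (f s) hvS
      · exact (hs v hv hvS).le.trans (Finset.le_sup' (f s) hw)
    · exact Finset.sup'_le _ _ fun v hv => Finset.le_sup' (f s) ((hmem v).1 hv).1
  rw [slope_def_field, hsup, hsupt]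
  -- For s > t the difference quotient is monotone in the value at s, so it commutes with the
  -- maximum; this is where one-sidedness enters.
  have hmono : Monotone fun x : ℝ => (x - f t w) / (s - t) := fun x y hxy => by
    dsimp only
    gcongr
  have := Finset.apply_sup'_eq_sup'_comp (s := S) ⟨w, hw⟩ (f := f s)
    (fun x : ℝ => (x - f t w) / (s - t)) fun x y => hmono.map_sup x y
  rw [this]
  refine Finset.sup'_congr _ rfl fun v hv => ?_
  rw [slope_def_field, Function.comp_apply, hval v hv]

theorem finset_inf'_eq_neg_sup' {V : Type*} {e : Finset V} (he : e.Nonempty) (f : V → ℝ) :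
    e.inf' he f = -e.sup' he (fun v => -f v) := by
  apply le_antisymm
  · exact le_neg.1 (Finset.sup'_le _ _ fun v hv => neg_le_neg (Finset.inf'_le f hv))
  · exact Finset.le_inf' _ _ fun v hv =>
      neg_le.1 (Finset.le_sup' (fun v => -f v) hv)

theorem hasDerivWithinAt_finset_inf' {V : Type*} {f : ℝ → V → ℝ} {r : V → ℝ} {t : ℝ}
    {e S : Finset V} (he : e.Nonempty) (hS : S.Nonempty)
    (hmem : ∀ v, v ∈ S ↔ v ∈ e ∧ ∀ u ∈ e, f t v ≤ f t u)
    (hf : ∀ v, HasDerivWithinAt (fun s => f s v) (r v) (Set.Ici t) t) :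
    HasDerivWithinAt (fun s => e.inf' he (f s)) (S.inf' hS r) (Set.Ici t) t := by
  simp only [finset_inf'_eq_neg_sup']
  exact (hasDerivWithinAt_finset_sup' (f := fun s v => -f s v) he hS
    (by simpa only [neg_le_neg_iff] using hmem) fun v => (hf v).neg).neg

/-- Continuity and right derivatives suffice for monotonicity, so the kinks of the flow do no harm.
-/
theorem le_of_right_deriv_nonpos {F F' : ℝ → ℝ} {a b : ℝ} (hab : a ≤ b)
    (hc : ContinuousOn F (Set.Icc a b))
    (hd : ∀ x ∈ Set.Ico a b, HasDerivWithinAt F (F' x) (Set.Ici x) x)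
    (hF' : ∀ x ∈ Set.Ico a b, F' x ≤ 0) : F b ≤ F a :=
  image_le_of_deriv_right_le_deriv_boundary (B := fun _ => F a) (B' := fun _ => 0) hc hd le_rfl
    continuousOn_const (fun _ _ => hasDerivWithinAt_const _ _ _) hF' (Set.right_mem_Icc.2 hab)

end RightDerivative

/-! ### Discrepancies and the energy -/

namespace WeightedHypergraph

variable {V : Type*} [Fintype V] [DecidableEq V]

theorem mem_maxSet {f : V → ℝ} {e : Finset V} {v : V} :
    v ∈ maxSet f e ↔ v ∈ e ∧ ∀ u ∈ e, f u ≤ f v := by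
  simp [maxSet]

theorem mem_minSet {f : V → ℝ} {e : Finset V} {v : V} :
    v ∈ minSet f e ↔ v ∈ e ∧ ∀ u ∈ e, f v ≤ f u := by
  simp [minSet]

theorem maxSet_nonempty (f : V → ℝ) {e : Finset V} (he : e.Nonempty) : (maxSet f e).Nonempty := by
  obtain ⟨v, hv, h⟩ := e.exists_max_image f he
  exact ⟨v, mem_maxSet.2 ⟨hv, h⟩⟩

theorem minSet_nonempty (f : V → ℝ) {e : Finset V} (he : e.Nonempty) : (minSet f e).Nonempty := by
  obtain ⟨v, hv, h⟩ := e.exists_min_image f he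
  exact ⟨v, mem_minSet.2 ⟨hv, h⟩⟩

theorem discrepancy_eq_add {f : V → ℝ} {e : Finset V} {u v : V} (hu : u ∈ maxSet f e)
    (hv : v ∈ minSet f e) : discrepancy f e = f u + f v := by
  rw [mem_maxSet] at hu
  rw [mem_minSet] at hv
  rw [discrepancy, dif_pos ⟨u, hu.1⟩]
  congr 1
  · exact le_antisymm (Finset.sup'_le _ _ hu.2) (Finset.le_sup' f hu.1)
  · exact le_antisymm (Finset.inf'_le f hv.1) (Finset.le_inf' _ _ hv.2)

theorem hasDerivWithinAt_discrepancy {f : ℝ → V → ℝ} {r : V → ℝ} {t : ℝ} {e : Finset V}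
    (he : e.Nonempty) (hf : ∀ v, HasDerivWithinAt (fun s => f s v) (r v) (Set.Ici t) t) :
    HasDerivWithinAt (fun s => discrepancy (f s) e)
      ((maxSet (f t) e).sup' (maxSet_nonempty _ he) r +
        (minSet (f t) e).inf' (minSet_nonempty _ he) r) (Set.Ici t) t := by
  simp only [discrepancy, dif_pos he]
  exact (hasDerivWithinAt_finset_sup' he _ (fun _ => mem_maxSet) hf).add
    (hasDerivWithinAt_finset_inf' he _ (fun _ => mem_minSet) hf)

theorem continuousOn_discrepancy {f : ℝ → V → ℝ} {s : Set ℝ} (hf : ContinuousOn f s)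
    (e : Finset V) : ContinuousOn (fun t => discrepancy (f t) e) s := by
  have hf' : ∀ v, ContinuousOn (fun t => f t v) s := fun v => continuousOn_pi.1 hf v
  by_cases he : e.Nonempty
  · simp only [discrepancy, dif_pos he]
    exact (ContinuousOn.finset_sup'_apply he fun v _ => hf' v).add
      (ContinuousOn.finset_inf'_apply he fun v _ => hf' v)
  · simp only [discrepancy, dif_neg he]
    exact continuousOn_const

theorem wInner_eq_sum (H : WeightedHypergraph V) (f h : V → ℝ) :
    H.wInner f h = ∑ v, H.deg v * (f v * h v) := by
  simp only [wInner, degMatrix, dotProduct, Matrix.mulVec_diagonal]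
  exact Finset.sum_congr rfl fun v _ => by ring

theorem wInner_comm (H : WeightedHypergraph V) (f h : V → ℝ) : H.wInner f h = H.wInner h f := by
  simp only [wInner_eq_sum, mul_comm]

/-- The numerator `∑ e, w(e) Δ_f(e) ^ 2` of the Rayleigh quotient of the diffusion operator. -/
noncomputable def energy (H : WeightedHypergraph V) (f : V → ℝ) : ℝ :=
  ∑ e ∈ H.edges, H.weight e * discrepancy f e ^ 2

theorem energy_nonneg (H : WeightedHypergraph V) (f : V → ℝ) : 0 ≤ H.energy f :=
  Finset.sum_nonneg fun e he => mul_nonneg (H.weight_pos e he).le (sq_nonneg _)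

theorem wInner_self_eq_sum_edges (H : WeightedHypergraph V) (f : V → ℝ) :
    H.wInner f f = ∑ e ∈ H.edges, H.weight e * ∑ v ∈ e, f v ^ 2 := by
  simp only [wInner_eq_sum, deg, Finset.sum_mul, Finset.mul_sum]
  rw [Finset.sum_comm]
  refine Finset.sum_congr rfl fun e _ => ?_
  simp only [ite_mul, zero_mul, Finset.sum_ite_mem, Finset.univ_inter, sq]

theorem energy_le (H : WeightedHypergraph V) (f : V → ℝ) : H.energy f ≤ 4 * H.wInner f f := by
  rw [wInner_self_eq_sum_edges, energy, Finset.mul_sum]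
  refine Finset.sum_le_sum fun e he => ?_
  obtain ⟨u, hu⟩ := maxSet_nonempty f (H.edge_nonempty e he)
  obtain ⟨v, hv⟩ := minSet_nonempty f (H.edge_nonempty e he)
  rw [discrepancy_eq_add hu hv]
  have h1 : f u ^ 2 ≤ ∑ v ∈ e, f v ^ 2 :=
    Finset.single_le_sum (f := fun v => f v ^ 2) (fun _ _ => sq_nonneg _) (mem_maxSet.1 hu).1
  have h2 : f v ^ 2 ≤ ∑ v ∈ e, f v ^ 2 :=
    Finset.single_le_sum (f := fun v => f v ^ 2) (fun _ _ => sq_nonneg _) (mem_minSet.1 hv).1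
  -- The two ends may be the same vertex, so each square is bounded by the whole sum; a one-element
  -- hyperedge attains the factor 4.
  have h3 : (f u + f v) ^ 2 ≤ 4 * ∑ v ∈ e, f v ^ 2 := by
    linarith [sq_nonneg (f u - f v), show (f u + f v) ^ 2 + (f u - f v) ^ 2 =
      2 * f u ^ 2 + 2 * f v ^ 2 by ring]
  calc H.weight e * (f u + f v) ^ 2 ≤ H.weight e * (4 * ∑ v ∈ e, f v ^ 2) :=
        mul_le_mul_of_nonneg_left h3 (H.weight_pos e he).le
    _ = _ := by ring

theorem sum_mul_ends (a : V → V → ℝ) (h : V → ℝ) :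
    ∑ u, h u * ((∑ v, a u v) + ∑ v, a v u) = ∑ u, ∑ v, a u v * (h u + h v) := by
  simp only [mul_add, Finset.mul_sum, Finset.sum_add_distrib]
  congr 1
  · simp only [mul_comm]
  · rw [Finset.sum_comm]
    simp only [mul_comm]

/-! ### Graphs representing the diffusion operator -/

namespace IsDiffusionGraph

variable {H : WeightedHypergraph V} {f : V → ℝ} {g : Finset V → V → V → ℝ}

theorem mul_add_eq (hg : H.IsDiffusionGraph f g) {e : Finset V} (he : e ∈ H.edges) (u v : V) :
    g e u v * (f u + f v) = discrepancy f e * g e u v := by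
  by_cases h : g e u v = 0
  · simp [h]
  · rw [discrepancy_eq_add (hg.support e he u v h).1 (hg.support e he u v h).2, mul_comm]

theorem deg_mul_edgeRate_eq (hg : H.IsDiffusionGraph f g) (hH : ∀ v, 0 < H.deg v)
    {e : Finset V} (he : e ∈ H.edges) (u : V) :
    H.deg u * H.edgeRate f g e u =
      -(discrepancy f e * ((∑ v, g e u v) + ∑ v, g e v u)) := by
  rw [deg_mul_edgeRate H hH, ← Finset.sum_add_distrib, Finset.mul_sum]
  congr 1
  refine Finset.sum_congr rfl fun v _ => ?_
  rw [mul_add (discrepancy f e), ← hg.mul_add_eq he u v, ← hg.mul_add_eq he v u]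
  ring

/-- Every graph edge carrying weight from e has end values summing to Δ_f(e). Taking h = f gives the
energy, and h = r gives ‖r‖_w², to be compared with the derivative of the energy. -/
theorem wInner_rate (hg : H.IsDiffusionGraph f g) (hH : ∀ v, 0 < H.deg v) (h : V → ℝ) :
    H.wInner h (H.rate f g) =
      -∑ e ∈ H.edges, discrepancy f e * ∑ u, ∑ v, g e u v * (h u + h v) := by
  have h1 : ∀ v, H.deg v * (h v * H.rate f g v) =
      ∑ e ∈ H.edges, h v * (H.deg v * H.edgeRate f g e v) := fun v => by
    rw [rate_eq_sum_edgeRate, Finset.mul_sum, Finset.mul_sum]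
    exact Finset.sum_congr rfl fun e _ => by ring
  simp only [wInner_eq_sum, h1]
  rw [Finset.sum_comm, ← Finset.sum_neg_distrib]
  refine Finset.sum_congr rfl fun e he => ?_
  rw [← sum_mul_ends, Finset.mul_sum, ← Finset.sum_neg_distrib]
  refine Finset.sum_congr rfl fun v _ => ?_
  rw [hg.deg_mul_edgeRate_eq hH he]
  ring

theorem wInner_self_rate (hg : H.IsDiffusionGraph f g) (hH : ∀ v, 0 < H.deg v) :
    H.wInner f (H.rate f g) = -H.energy f := by
  rw [hg.wInner_rate hH, energy]
  congr 1
  refine Finset.sum_congr rfl fun e he => ?_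
  simp only [hg.mul_add_eq he, ← Finset.mul_sum, hg.total e he]
  ring

/-- Shares may be negative and cancel at a vertex; what decides participation is the net weight
there. -/
theorem edgeRate_ne_zero (hg : H.IsDiffusionGraph f g) (hH : ∀ v, 0 < H.deg v)
    {e : Finset V} (he : e ∈ H.edges) (hd : discrepancy f e ≠ 0) {u : V}
    (hu : (∑ v, g e u v) + ∑ v, g e v u ≠ 0) : 0 < |H.edgeRate f g e u| := by
  rw [abs_pos]
  intro h0
  have := hg.deg_mul_edgeRate_eq hH he u
  rw [h0, mul_zero, eq_comm, neg_eq_zero] at this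
  exact mul_ne_zero hd hu this

theorem rate_eq_sup' (hg : H.IsDiffusionGraph f g) {e : Finset V} (he : e ∈ H.edges)
    (hd : discrepancy f e ≠ 0) {u : V} (hu : u ∈ maxSet f e)
    (hr : 0 < |H.edgeRate f g e u|) :
    H.rate f g u = (maxSet f e).sup' (maxSet_nonempty f (H.edge_nonempty e he)) (H.rate f g) := by
  refine le_antisymm (Finset.le_sup' (H.rate f g) hu) (Finset.sup'_le _ _ fun v hv => ?_)
  rcases hd.lt_or_gt with h | h
  · exact (hg.max_of_neg e he h u hu hr v hv).ge
  · exact hg.max_of_pos e he h u hu hr v hv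

theorem rate_eq_inf' (hg : H.IsDiffusionGraph f g) {e : Finset V} (he : e ∈ H.edges)
    (hd : discrepancy f e ≠ 0) {u : V} (hu : u ∈ minSet f e)
    (hr : 0 < |H.edgeRate f g e u|) :
    H.rate f g u = (minSet f e).inf' (minSet_nonempty f (H.edge_nonempty e he)) (H.rate f g) := by
  refine le_antisymm (Finset.le_inf' _ _ fun v hv => ?_) (Finset.inf'_le (H.rate f g) hu)
  rcases hd.lt_or_gt with h | h
  · exact hg.min_of_neg e he h u hu hr v hv
  · exact (hg.min_of_pos e he h u hu hr v hv).le

theorem sum_left_eq_zero (hg : H.IsDiffusionGraph f g) {e : Finset V} (he : e ∈ H.edges) {u : V}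
    (hu : u ∉ maxSet f e) : ∑ v, g e u v = 0 :=
  Finset.sum_eq_zero fun v _ => by
    by_contra h
    exact hu (hg.support e he u v h).1

theorem sum_right_eq_zero (hg : H.IsDiffusionGraph f g) {e : Finset V} (he : e ∈ H.edges) {u : V}
    (hu : u ∉ minSet f e) : ∑ v, g e v u = 0 :=
  Finset.sum_eq_zero fun v _ => by
    by_contra h
    exact hu (hg.support e he v u h).2

theorem minSet_eq_maxSet_of_not_disjoint {f : V → ℝ} {e : Finset V}
    (h : ¬ Disjoint (maxSet f e) (minSet f e)) : minSet f e = maxSet f e := by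
  obtain ⟨w, hw1, hw2⟩ := Finset.not_disjoint_iff.1 h
  rw [mem_maxSet] at hw1
  rw [mem_minSet] at hw2
  have hc : ∀ u ∈ e, f u = f w := fun u hu => le_antisymm (hw1.2 u hu) (hw2.2 u hu)
  ext v
  rw [mem_minSet, mem_maxSet]
  refine and_congr_right fun hv => forall₂_congr fun u hu => ?_
  rw [hc u hu, hc v hv]

/-- The participation rules: the edges of `G` coming from `e` see the extremal rates of `e`. -/
theorem sum_mul_rate (hg : H.IsDiffusionGraph f g) (hH : ∀ v, 0 < H.deg v)
    {e : Finset V} (he : e ∈ H.edges) (hd : discrepancy f e ≠ 0) :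
    ∑ u, ∑ v, g e u v * (H.rate f g u + H.rate f g v) =
      H.weight e * ((maxSet f e).sup' (maxSet_nonempty f (H.edge_nonempty e he)) (H.rate f g) +
        (minSet f e).inf' (minSet_nonempty f (H.edge_nonempty e he)) (H.rate f g)) := by
  have hmax := fun u hu hr => hg.rate_eq_sup' he hd (u := u) hu hr
  have hmin := fun u hu hr => hg.rate_eq_inf' he hd (u := u) hu hr
  generalize (maxSet f e).sup' (maxSet_nonempty f (H.edge_nonempty e he)) (H.rate f g) = M at *
  generalize (minSet f e).inf' (minSet_nonempty f (H.edge_nonempty e he)) (H.rate f g) = m at *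
  rw [← sum_mul_ends]
  have hcol : ∑ u, ∑ v, g e v u = H.weight e := by rw [Finset.sum_comm, hg.total e he]
  by_cases hdis : Disjoint (maxSet f e) (minSet f e)
  · have key : ∀ u, H.rate f g u * ((∑ v, g e u v) + ∑ v, g e v u) =
        M * (∑ v, g e u v) + m * ∑ v, g e v u := by
      intro u
      -- By disjointness at most one of the two sums is nonzero, so a zero total makes both vanish.
      by_cases h0 : (∑ v, g e u v) + ∑ v, g e v u = 0
      · by_cases hu : u ∈ maxSet f e
        · rw [hg.sum_right_eq_zero he (Finset.disjoint_left.1 hdis hu)] at h0 ⊢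
          rw [add_zero] at h0
          simp [h0]
        · rw [hg.sum_left_eq_zero he hu] at h0 ⊢
          rw [zero_add] at h0
          simp [h0]
      · have hr := hg.edgeRate_ne_zero hH he hd h0
        by_cases hu : u ∈ maxSet f e
        · rw [hg.sum_right_eq_zero he (Finset.disjoint_left.1 hdis hu), hmax u hu hr]
          ring
        · rw [hg.sum_left_eq_zero he hu] at h0 ⊢
          have hu' : u ∈ minSet f e := by
            by_contra h
            exact h0 (by rw [hg.sum_right_eq_zero he h, zero_add])
          rw [hmin u hu' hr]
          ring
    rw [Finset.sum_congr rfl fun u _ => key u, Finset.sum_add_distrib, ← Finset.mul_sum,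
      ← Finset.mul_sum, hcol, hg.total e he]
    ring
  · have hSI := minSet_eq_maxSet_of_not_disjoint hdis
    have hmem : ∀ u, (∑ v, g e u v) + ∑ v, g e v u ≠ 0 → u ∈ maxSet f e := fun u h0 => by
      by_contra h
      exact h0 (by rw [hg.sum_left_eq_zero he h, hg.sum_right_eq_zero he (hSI ▸ h), zero_add])
    have htot : ∑ u, ((∑ v, g e u v) + ∑ v, g e v u) = 2 * H.weight e := by
      rw [Finset.sum_add_distrib, hcol, hg.total e he]
      ring
    -- Here f is constant on e. The net weights add up to 2w(e) ≠ 0, so some vertex participates,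
    -- and its rate is both the maximum and the minimum.
    have hMm : M = m := by
      obtain ⟨u, -, hu⟩ := Finset.exists_ne_zero_of_sum_ne_zero
        (htot.trans_ne (mul_pos two_pos (H.weight_pos e he)).ne')
      have hr := hg.edgeRate_ne_zero hH he hd hu
      rw [← hmax u (hmem u hu) hr, ← hmin u (hSI ▸ hmem u hu) hr]
    have key : ∀ u, H.rate f g u * ((∑ v, g e u v) + ∑ v, g e v u) =
        M * ((∑ v, g e u v) + ∑ v, g e v u) := by
      intro u
      by_cases h0 : (∑ v, g e u v) + ∑ v, g e v u = 0
      · rw [h0, mul_zero, mul_zero]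
      · rw [hmax u (hmem u h0) (hg.edgeRate_ne_zero hH he hd h0)]
    rw [Finset.sum_congr rfl fun u _ => key u, ← Finset.mul_sum, htot, ← hMm]
    ring

end IsDiffusionGraph

/-! ### Norm, energy and Rayleigh quotient along the flow -/

namespace IsDiffusion

variable {H : WeightedHypergraph V} {f : ℝ → V → ℝ} {g : ℝ → Finset V → V → V → ℝ}

theorem hasDerivWithinAt_apply (hf : H.IsDiffusion f g) {t : ℝ} (ht : 0 ≤ t) (v : V) :
    HasDerivWithinAt (fun s => f s v) (H.rate (f t) (g t) v) (Set.Ici t) t :=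
  hasDerivWithinAt_pi.1 (hf.deriv t ht) v

theorem continuousOn_wInner (hf : H.IsDiffusion f g) :
    ContinuousOn (fun t => H.wInner (f t) (f t)) (Set.Ici 0) := by
  have := fun v => continuousOn_pi.1 hf.continuousOn v
  simp only [wInner_eq_sum]
  fun_prop

theorem continuousOn_energy (hf : H.IsDiffusion f g) :
    ContinuousOn (fun t => H.energy (f t)) (Set.Ici 0) := by
  have := continuousOn_discrepancy hf.continuousOn
  simp only [energy]
  fun_prop

theorem hasDerivWithinAt_wInner (hf : H.IsDiffusion f g) (hH : ∀ v, 0 < H.deg v) {t : ℝ}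
    (ht : 0 ≤ t) :
    HasDerivWithinAt (fun s => H.wInner (f s) (f s)) (-2 * H.energy (f t)) (Set.Ici t) t := by
  have h : -2 * H.energy (f t) = ∑ v, H.deg v *
      (H.rate (f t) (g t) v * f t v + f t v * H.rate (f t) (g t) v) := by
    have := (hf.graph t ht).wInner_self_rate hH
    rw [wInner_eq_sum] at this
    rw [neg_mul, ← mul_neg, ← this, Finset.mul_sum]
    exact Finset.sum_congr rfl fun v _ => by ring
  rw [h]
  simp only [wInner_eq_sum]
  exact HasDerivWithinAt.fun_sum fun v _ =>
    ((hf.hasDerivWithinAt_apply ht v).mul (hf.hasDerivWithinAt_apply ht v)).const_mul _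

theorem hasDerivWithinAt_energy (hf : H.IsDiffusion f g) (hH : ∀ v, 0 < H.deg v) {t : ℝ}
    (ht : 0 ≤ t) :
    HasDerivWithinAt (fun s => H.energy (f s))
      (-2 * H.wInner (H.rate (f t) (g t)) (H.rate (f t) (g t))) (Set.Ici t) t := by
  have hg := hf.graph t ht
  rw [hg.wInner_rate hH, neg_mul_neg, Finset.mul_sum]
  refine HasDerivWithinAt.fun_sum fun e he => ?_
  have hd := ((hasDerivWithinAt_discrepancy (H.edge_nonempty e he)
    (hf.hasDerivWithinAt_apply ht)).pow 2).const_mul (H.weight e)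
  refine hd.congr_deriv ?_
  -- At zero discrepancy the rules say nothing, but the derivative of the square vanishes anyway.
  by_cases h0 : discrepancy (f t) e = 0
  · simp [h0]
  · rw [hg.sum_mul_rate hH he h0]
    push_cast
    ring

/-- From N' = -2E ≥ -8N the product N·exp(8t) never decreases. -/
theorem wInner_pos (hf : H.IsDiffusion f g) (hH : ∀ v, 0 < H.deg v) (h0 : f 0 ≠ 0) {t : ℝ}
    (ht : 0 ≤ t) : 0 < H.wInner (f t) (f t) := by
  have hpos : 0 < H.wInner (f 0) (f 0) := by
    obtain ⟨v, hv⟩ := Function.ne_iff.1 h0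
    rw [wInner_eq_sum]
    exact Finset.sum_pos' (fun u _ => mul_nonneg (hH u).le (mul_self_nonneg _))
      ⟨v, Finset.mem_univ v, mul_pos (hH v) (mul_self_pos.2 hv)⟩
  have hexp : ∀ x : ℝ, HasDerivAt (fun s : ℝ => Real.exp (8 * s)) (Real.exp (8 * x) * 8) x :=
    fun x => by simpa using ((hasDerivAt_id x).const_mul 8).exp
  have hle := le_of_right_deriv_nonpos (F := fun s => -(H.wInner (f s) (f s) * Real.exp (8 * s)))
    ht ((hf.continuousOn_wInner.mono Set.Icc_subset_Ici_self).mul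
      (by fun_prop)).neg
    (fun x hx => ((hf.hasDerivWithinAt_wInner hH hx.1).mul (hexp x).hasDerivWithinAt).neg)
    (fun x _ => by
      have := mul_nonneg (Real.exp_pos (8 * x)).le (sub_nonneg.2 (H.energy_le (f x)))
      linarith)
  simp only [mul_zero, Real.exp_zero, mul_one, neg_le_neg_iff] at hle
  exact pos_of_mul_pos_left (hpos.trans_le hle) (Real.exp_pos _).le

/-- The Rayleigh quotient decreases at twice the rate of the variance of the spectral measure, so
the variance is small at some time. -/
theorem exists_variance_le (hf : H.IsDiffusion f g) (hH : ∀ v, 0 < H.deg v) (h0 : f 0 ≠ 0)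
    {δ : ℝ} (hδ : 0 < δ) :
    ∃ t, 0 ≤ t ∧ t ≤ 3 / δ ∧
      H.wInner (f t) (f t) * H.wInner (H.rate (f t) (g t)) (H.rate (f t) (g t)) -
        H.energy (f t) ^ 2 ≤ δ * H.wInner (f t) (f t) ^ 2 := by
  by_contra! hcon
  have hT : 0 ≤ 3 / δ := by positivity
  have hN : ∀ x, 0 ≤ x → H.wInner (f x) (f x) ≠ 0 := fun x hx => (hf.wInner_pos hH h0 hx).ne'
  -- If the variance exceeded δ throughout, R + 2δs would not increase. By time 3/δ this forces a
  -- drop of 6, while R starts at most at 4 and stays nonnegative.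
  have hle := le_of_right_deriv_nonpos
    (F := fun s => H.energy (f s) / H.wInner (f s) (f s) + 2 * δ * s) hT
    (((hf.continuousOn_energy.div hf.continuousOn_wInner fun x hx => hN x hx).mono
      Set.Icc_subset_Ici_self).add (by fun_prop))
    (fun x hx => ((hf.hasDerivWithinAt_energy hH hx.1).div (hf.hasDerivWithinAt_wInner hH hx.1)
      (hN x hx.1)).add ((hasDerivAt_id x).const_mul (2 * δ)).hasDerivWithinAt)
    (fun x hx => by
      have h1 := hcon x hx.1 hx.2.le
      have h2 := hf.wInner_pos hH h0 hx.1
      rw [mul_one, ← le_neg_iff_add_nonpos_right, div_le_iff₀ (by positivity)]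
      linarith)
  have h1 : 0 ≤ H.energy (f (3 / δ)) / H.wInner (f (3 / δ)) (f (3 / δ)) :=
    div_nonneg (H.energy_nonneg _) (hf.wInner_pos hH h0 hT).le
  have h2 : H.energy (f 0) / H.wInner (f 0) (f 0) ≤ 4 :=
    (div_le_iff₀ (hf.wInner_pos hH h0 le_rfl)).2 (H.energy_le _)
  have h3 : 2 * δ * (3 / δ) = 6 := by
    field_simp
    norm_num
  simp only [h3, mul_zero, add_zero] at hle
  linarith

end IsDiffusion

/-! ### Spectral decomposition of D_H⁻¹J -/

theorem degMatrix_inv (H : WeightedHypergraph V) (hH : ∀ v, 0 < H.deg v) :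
    H.degMatrix⁻¹ = Matrix.diagonal fun v => (H.deg v)⁻¹ := by
  apply Matrix.inv_eq_left_inv
  rw [degMatrix, Matrix.diagonal_mul_diagonal, ← Matrix.diagonal_one]
  congr 1
  funext v
  exact inv_mul_cancel₀ (hH v).ne'

theorem signlessLaplacian_isSymm {A : Matrix V V ℝ} (hA : A.IsSymm) :
    (signlessLaplacian A).IsSymm :=
  (Matrix.isSymm_diagonal _).add hA

theorem graphAdj_isSymm (H : WeightedHypergraph V) (g : Finset V → V → V → ℝ) :
    (H.graphAdj g).IsSymm := by
  ext u v
  simp only [Matrix.transpose_apply, graphAdj, Matrix.sum_apply, edgeAdj, Matrix.of_apply,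
    add_comm]

theorem wInner_sum_smul_left (H : WeightedHypergraph V) {ι : Type*} (s : Finset ι) (a : ι → ℝ)
    (u : ι → V → ℝ) (h : V → ℝ) :
    H.wInner (∑ i ∈ s, a i • u i) h = ∑ i ∈ s, a i * H.wInner (u i) h := by
  simp only [wInner_eq_sum, Finset.sum_apply, Pi.smul_apply, smul_eq_mul, Finset.sum_mul,
    Finset.mul_sum]
  rw [Finset.sum_comm]
  exact Finset.sum_congr rfl fun i _ => Finset.sum_congr rfl fun v _ => by ring

/-- The spectral theorem for `D_H⁻¹ J` with `J` symmetric: it is conjugate to the symmetric matrix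
`D_H^{-1/2} J D_H^{-1/2}`. -/
theorem exists_isEigenSystem (H : WeightedHypergraph V) (hH : ∀ v, 0 < H.deg v)
    (g : Finset V → V → V → ℝ) :
    ∃ u lam, H.IsEigenSystem (H.diffusionMatrix g) u lam := by
  set J := signlessLaplacian (H.graphAdj g) with hJ
  set s : V → ℝ := fun v => √(H.deg v) with hs
  have hs0 : ∀ v, s v ≠ 0 := fun v => (Real.sqrt_pos.2 (hH v)).ne'
  have hss : ∀ v, H.deg v = s v * s v := fun v => (Real.mul_self_sqrt (hH v).le).symm
  have hB : (Matrix.of fun v w => (s v)⁻¹ * J v w * (s w)⁻¹).IsHermitian := by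
    ext v w
    have h := (signlessLaplacian_isSymm (H.graphAdj_isSymm g)).apply v w
    simp only [Matrix.conjTranspose_apply, Matrix.of_apply, star_trivial, hJ, h]
    ring
  let o : Fin (Fintype.card V) ≃ V := (Fintype.equivFin V).symm
  -- D_H^{-1/2} turns Euclidean orthonormality into orthonormality for ⟨·,·⟩_w.
  refine ⟨fun i v => (s v)⁻¹ * hB.eigenvectorBasis (o i) v, fun i => hB.eigenvalues (o i),
    fun i j => ?_, fun i => ?_⟩
  · have h := orthonormal_iff_ite.1 hB.eigenvectorBasis.orthonormal (o i) (o j)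
    simp only [o.injective.eq_iff] at h
    rw [← h, wInner_eq_sum, PiLp.inner_apply]
    refine Finset.sum_congr rfl fun v _ => ?_
    have := hs0 v
    rw [hss v]
    simp only [RCLike.inner_apply, conj_trivial]
    field_simp
  · funext v
    have h := congrFun (hB.mulVec_eigenvectorBasis (o i)) v
    simp only [Matrix.mulVec, dotProduct, Matrix.of_apply, Pi.smul_apply, smul_eq_mul] at h
    rw [diffusionMatrix, ← hJ, degMatrix_inv H hH, ← Matrix.mulVec_mulVec, Matrix.mulVec_diagonal]
    simp only [Matrix.mulVec, dotProduct, Pi.smul_apply, smul_eq_mul]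
    rw [mul_left_comm, ← h, hss v, mul_inv, mul_assoc, Finset.mul_sum, Finset.mul_sum,
      Finset.mul_sum]
    exact Finset.sum_congr rfl fun w _ => by ring

namespace IsEigenSystem

variable {H : WeightedHypergraph V} {M : Matrix V V ℝ} {u : Fin (Fintype.card V) → V → ℝ}
  {lam : Fin (Fintype.card V) → ℝ}

theorem wInner_sum_smul (hu : H.IsEigenSystem M u lam) (a b : Fin (Fintype.card V) → ℝ) :
    H.wInner (∑ i, a i • u i) (∑ i, b i • u i) = ∑ i, a i * b i := by
  rw [wInner_sum_smul_left]
  refine Finset.sum_congr rfl fun i _ => ?_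
  rw [wInner_comm, wInner_sum_smul_left]
  simp [hu.orthonormal]

theorem linearIndependent (hu : H.IsEigenSystem M u lam) : LinearIndependent ℝ u := by
  rw [Fintype.linearIndependent_iff]
  intro a ha i
  have h := H.wInner_sum_smul_left Finset.univ a u (u i)
  rw [ha] at h
  simpa [hu.orthonormal, wInner_eq_sum] using h.symm

/-- An orthonormal family is independent, and n independent vectors span. -/
theorem sum_wInner_smul (hu : H.IsEigenSystem M u lam) (f : V → ℝ) :
    ∑ i, H.wInner f (u i) • u i = f := by
  have hspan := hu.linearIndependent.span_eq_top_of_card_eq_finrank' (by simp)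
  have hf : f ∈ Submodule.span ℝ (Set.range u) := hspan ▸ Submodule.mem_top
  obtain ⟨c, hc⟩ := (Submodule.mem_span_range_iff_exists_fun ℝ).1 hf
  conv_rhs => rw [← hc]
  refine Finset.sum_congr rfl fun i _ => ?_
  rw [← hc, wInner_sum_smul_left]
  simp [hu.orthonormal]

theorem mulVec_eq_sum (hu : H.IsEigenSystem M u lam) (f : V → ℝ) :
    M.mulVec f = ∑ i, (lam i * H.wInner f (u i)) • u i := by
  conv_lhs => rw [← hu.sum_wInner_smul f, Matrix.mulVec_sum]
  refine Finset.sum_congr rfl fun i _ => ?_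
  rw [Matrix.mulVec_smul, hu.eigen, smul_smul, mul_comm]

theorem wInner_self (hu : H.IsEigenSystem M u lam) (f : V → ℝ) :
    H.wInner f f = ∑ i, H.wInner f (u i) ^ 2 := by
  conv_lhs => rw [← hu.sum_wInner_smul f, hu.wInner_sum_smul]
  simp only [sq]

theorem wInner_self_mulVec (hu : H.IsEigenSystem M u lam) (f : V → ℝ) :
    H.wInner f (M.mulVec f) = ∑ i, lam i * H.wInner f (u i) ^ 2 := by
  conv_lhs => rw [hu.mulVec_eq_sum f]
  conv_lhs => enter [2]; rw [← hu.sum_wInner_smul f]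
  rw [hu.wInner_sum_smul]
  exact Finset.sum_congr rfl fun i _ => by ring

theorem wInner_mulVec_mulVec (hu : H.IsEigenSystem M u lam) (f : V → ℝ) :
    H.wInner (M.mulVec f) (M.mulVec f) = ∑ i, lam i ^ 2 * H.wInner f (u i) ^ 2 := by
  rw [hu.mulVec_eq_sum f, hu.wInner_sum_smul]
  exact Finset.sum_congr rfl fun i _ => by ring

end IsEigenSystem

/-- Chebyshev's inequality for a finite measure with masses `a i` at the points `lam i`. -/
theorem chebyshev_sum {ι : Type*} [Fintype ι] (a lam : ι → ℝ) (ha : ∀ i, 0 ≤ a i) {N Q S ε : ℝ}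
    (hε : 0 < ε) (hNpos : 0 < N) (hN : N = ∑ i, a i) (hQ : Q = ∑ i, lam i * a i)
    (hS : S = ∑ i, lam i ^ 2 * a i) (hvar : N * S - Q ^ 2 ≤ ε ^ 3 * N ^ 2) :
    (1 - ε) * N ≤ ∑ i with Q / N - ε ≤ lam i ∧ lam i ≤ Q / N - ε + 2 * ε, a i := by
  set R := Q / N with hR
  have hQR : Q = R * N := by rw [hR, div_mul_cancel₀ _ hNpos.ne']
  -- N times the second moment about the mean R = Q/N is NS - Q².
  have hvar' : ∑ i, (lam i - R) ^ 2 * a i ≤ ε ^ 3 * N := by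
    have h1 : ∑ i, (lam i - R) ^ 2 * a i = S - 2 * R * Q + R ^ 2 * N := by
      rw [hS, hN]
      conv_rhs => rw [hQ]
      rw [Finset.mul_sum, Finset.mul_sum, ← Finset.sum_sub_distrib, ← Finset.sum_add_distrib]
      exact Finset.sum_congr rfl fun i _ => by ring
    rw [h1]
    refine le_of_mul_le_mul_left ?_ hNpos
    rw [hQR] at hvar ⊢
    linarith
  have hout : ε ^ 2 * ∑ i with ¬ (R - ε ≤ lam i ∧ lam i ≤ R - ε + 2 * ε), a i ≤
      ∑ i, (lam i - R) ^ 2 * a i := by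
    rw [Finset.mul_sum]
    refine (Finset.sum_le_sum fun i hi => ?_).trans
      (Finset.sum_le_sum_of_subset_of_nonneg (Finset.filter_subset _ _)
        fun i _ _ => mul_nonneg (sq_nonneg _) (ha i))
    refine mul_le_mul_of_nonneg_right ?_ (ha i)
    have hi := (Finset.mem_filter.1 hi).2
    refine sq_le_sq.2 ((abs_of_pos hε).le.trans ?_)
    by_contra! h
    rw [abs_lt] at h
    exact hi ⟨by linarith, by linarith⟩
  -- Cancelling ε² from the bound ε³N is what leaves εN.
  have hle : ∑ i with ¬ (R - ε ≤ lam i ∧ lam i ≤ R - ε + 2 * ε), a i ≤ ε * N :=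
    le_of_mul_le_mul_left (by linarith) (pow_pos hε 2)
  have hsplit := Finset.sum_filter_add_sum_filter_not Finset.univ
    (fun i => R - ε ≤ lam i ∧ lam i ≤ R - ε + 2 * ε) a
  linarith

end WeightedHypergraph

/-! ### Conclusion -/

theorem mainTheorem4 :
    ∃ C : ℝ, 0 < C ∧
      ∀ (V : Type*) [Fintype V] [DecidableEq V] (H : WeightedHypergraph V),
        (∀ v, 0 < H.deg v) →
        ∀ ε : ℝ, 0 < ε →
        ∀ (f : ℝ → V → ℝ) (g : ℝ → Finset V → V → V → ℝ),
          H.IsDiffusion f g → f 0 ≠ 0 →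
          ∃ t : ℝ, 0 ≤ t ∧ t ≤ C / ε ^ 3 ∧ 0 < H.wNorm (f t) ∧
            ∃ c : ℝ,
              (∃ u lam, H.IsEigenSystem (H.diffusionMatrix (g t)) u lam) ∧
              ∀ u lam, H.IsEigenSystem (H.diffusionMatrix (g t)) u lam →
                1 - ε ≤ 1 / H.wNorm (f t) ^ 2 *
                    ∑ i with c ≤ lam i ∧ lam i ≤ c + 2 * ε, H.wInner (f t) (u i) ^ 2 ∧
                1 - ε ≤ 1 / H.wNorm (f t) *
                    ∑ i with c ≤ lam i ∧ lam i ≤ c + 2 * ε, |H.wInner (f t) (u i)| := by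
  refine ⟨3, three_pos, fun V _ _ H hH ε hε f g hf h0 => ?_⟩
  obtain ⟨t, ht, htle, hvar⟩ := hf.exists_variance_le hH h0 (pow_pos hε 3)
  have hN := hf.wInner_pos hH h0 ht
  have hsq : H.wNorm (f t) ^ 2 = H.wInner (f t) (f t) := Real.sq_sqrt hN.le
  have hnorm : 0 < H.wNorm (f t) := Real.sqrt_pos.2 hN
  refine ⟨t, ht, htle, hnorm, H.energy (f t) / H.wInner (f t) (f t) - ε,
    H.exists_isEigenSystem hH (g t), fun u lam hu => ?_⟩
  have hrate : H.rate (f t) (g t) = -(H.diffusionMatrix (g t)).mulVec (f t) := rfl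
  have hQ : H.energy (f t) = ∑ i, lam i * H.wInner (f t) (u i) ^ 2 := by
    rw [← hu.wInner_self_mulVec, ← neg_inj, ← (hf.graph t ht).wInner_self_rate hH, hrate]
    simp [WeightedHypergraph.wInner_eq_sum]
  have hS : H.wInner (H.rate (f t) (g t)) (H.rate (f t) (g t)) =
      ∑ i, lam i ^ 2 * H.wInner (f t) (u i) ^ 2 := by
    rw [← hu.wInner_mulVec_mulVec, hrate]
    simp [WeightedHypergraph.wInner_eq_sum]
  have hmain := WeightedHypergraph.chebyshev_sum _ lam (fun i => sq_nonneg (H.wInner (f t) (u i)))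
    hε hN (hu.wInner_self (f t)) hQ hS hvar
  have habs : ∀ i, |H.wInner (f t) (u i)| ≤ H.wNorm (f t) := fun i => by
    refine abs_le_of_sq_le_sq ?_ hnorm.le
    rw [hsq, hu.wInner_self (f t)]
    exact Finset.single_le_sum (f := fun i => H.wInner (f t) (u i) ^ 2)
      (fun _ _ => sq_nonneg _) (Finset.mem_univ i)
  constructor
  · rwa [hsq, one_div_mul_eq_div, le_div_iff₀ hN]
  · rw [one_div_mul_eq_div, le_div_iff₀ hnorm]
    -- Each coefficient is at most ‖f‖_w in absolute value, so its square is at most ‖f‖_w times its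
    -- absolute value; the ℓ¹ bound thus follows from the ℓ² bound.
    refine le_of_mul_le_mul_right ?_ hnorm
    rw [mul_assoc, ← sq, hsq, Finset.sum_mul]
    refine hmain.trans (Finset.sum_le_sum fun i _ => ?_)
    rw [← sq_abs, sq]
    exact mul_le_mul_of_nonneg_left (habs i) (abs_nonneg _)
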